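/- Let $U,V\subset\mathbb C$ be open discs and let $\mathcal O=\mathcal O(U\times V)$ and $\mathcal M=\mathcal M(U\times V)$ be the holomorphic and the meromorphic functions of $(t,\varepsilon)\in U\times V$. Let $\dot x=A(t,\varepsilon)x$, $x=(x_1,\dots,x_n)^T$, $n\ge 1$, be a linear differential system whose $n\times n$ coefficient matrix $A$ has entries in $\mathcal O$. Define row vectors $a^{(i)}\in\mathcal O^n$ by $a^{(0)}=(1,0,\dots,0)$ and $a^{(i+1)}=\partial_t a^{(i)}+a^{(i)}A$, so that $x_1^{(i)}=a^{(i)}x$ along solutions. Let $k$ be the least integer such that $a^{(0)},\dots,a^{(k)}$ are linearly dependent over $\mathcal M$, and let $a^{(k)}=A_{k-1}a^{(k-1)}+\dots+A_0a^{(0)}$ be the unique decomposition with $A_i\in\mathcal M$. The equation $$x_1^{(k)}-A_{k-1}x_1^{(k-1)}-\dots-A_0x_1=0$$ is called the derived equation for $x_1$. A function $f\in\mathcal M$ is called singularly perturbed at $\varepsilon_0\in V$ if, when it is written as $f=u/v$ with $u,v\in\mathcal O$, $v\not\equiv 0$, the denominator $v$ is divisible in $\mathcal O$ by a strictly higher power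 of $\varepsilon-\varepsilon_0$ than the numerator $u$ (the zero function is divisible by every power); this does not depend on the choice of $u$ and $v$. A scalar equation with leading coefficient $1$ is called singularly perturbed if at least one of its coefficients is singularly perturbed at some $\varepsilon_0\in V$. **Theorem.** The derived equation for $x_1$ is not singularly perturbed. -/

import Mathlib

/-- An open polydisc `U × V` in `ℂ × ℂ`: the time `t` ranges over the disc `U`, the parameter `ε`
over the disc `V`. -/
structure Polydisc where
  tCenter : ℂ
  tRadius : ℝ
  tRadius_pos : 0 < tRadius
  epsCenter : ℂ
  epsRadius : ℝ
  epsRadius_pos : 0 < epsRadius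

namespace Polydisc

/-- The disc `U` of times. -/
def U (P : Polydisc) : Set ℂ := Metric.ball P.tCenter P.tRadius

/-- The disc `V` of parameters. -/
def V (P : Polydisc) : Set ℂ := Metric.ball P.epsCenter P.epsRadius

/-- The polydisc `U × V` as a set of pairs `(t, ε)`. -/
def toSet (P : Polydisc) : Set (ℂ × ℂ) := P.U ×ˢ P.V

theorem isOpen_toSet (P : Polydisc) : IsOpen P.toSet :=
  Metric.isOpen_ball.prod Metric.isOpen_ball

theorem isPreconnected_toSet (P : Polydisc) : IsPreconnected P.toSet :=
  ((convex_ball _ _).prod (convex_ball _ _)).isPreconnected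

theorem center_mem (P : Polydisc) : (P.tCenter, P.epsCenter) ∈ P.toSet :=
  ⟨Metric.mem_ball_self P.tRadius_pos, Metric.mem_ball_self P.epsRadius_pos⟩

/-- Extension by zero of a function on the polydisc to all of `ℂ × ℂ`. Since the polydisc is open,
analyticity and derivatives at its points do not depend on the way the function is extended. -/
noncomputable def ext (P : Polydisc) (f : P.toSet → ℂ) : ℂ × ℂ → ℂ :=
  Function.extend Subtype.val f 0

theorem ext_apply (P : Polydisc) (f : P.toSet → ℂ) (z : P.toSet) : P.ext f z = f z :=
  Subtype.val_injective.extend_apply f 0 z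

theorem ext_congr (P : Polydisc) {f : P.toSet → ℂ} {F : ℂ × ℂ → ℂ}
    (h : ∀ z : P.toSet, f z = F z) : Set.EqOn F (P.ext f) P.toSet := by
  intro z hz
  rw [P.ext_apply f ⟨z, hz⟩, h ⟨z, hz⟩]

theorem analytic_ext (P : Polydisc) {f : P.toSet → ℂ} {F : ℂ × ℂ → ℂ}
    (hF : AnalyticOnNhd ℂ F P.toSet) (h : ∀ z : P.toSet, f z = F z) :
    AnalyticOnNhd ℂ (P.ext f) P.toSet :=
  hF.congr P.isOpen_toSet (P.ext_congr h)

/-- The ring `𝒪(U × V)` of holomorphic functions of `(t, ε)` on the polydisc. -/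
def Hol (P : Polydisc) : Subring (P.toSet → ℂ) where
  carrier := {f | AnalyticOnNhd ℂ (P.ext f) P.toSet}
  mul_mem' {f g} hf hg :=
    P.analytic_ext (F := P.ext f * P.ext g) (hf.mul hg) fun z => by simp [P.ext_apply]
  one_mem' := P.analytic_ext (F := fun _ => 1) analyticOnNhd_const fun z => rfl
  add_mem' {f g} hf hg :=
    P.analytic_ext (F := P.ext f + P.ext g) (hf.add hg) fun z => by simp [P.ext_apply]
  zero_mem' := P.analytic_ext (F := fun _ => 0) analyticOnNhd_const fun z => rfl
  neg_mem' {f} hf :=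
    P.analytic_ext (F := -P.ext f) hf.neg fun z => by simp [P.ext_apply]

instance (P : Polydisc) : Nontrivial P.Hol :=
  ⟨0, 1, fun h => zero_ne_one
    (congrFun (congrArg Subtype.val h) ⟨_, P.center_mem⟩ : (0 : ℂ) = 1)⟩

instance (P : Polydisc) : NoZeroDivisors P.Hol where
  eq_zero_or_eq_zero_of_mul_eq_zero {f g} hfg := by
    by_contra! hne
    obtain ⟨z, hz⟩ : ∃ z, f.1 z ≠ 0 := by
      by_contra! h
      exact hne.1 (Subtype.ext (funext h))
    refine hne.2 (Subtype.ext (funext fun w => ?_))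
    have hcont : ContinuousAt (P.ext f.1) z := (f.2 z z.2).continuousAt
    have hz' : P.ext f.1 z ≠ 0 := by rwa [P.ext_apply]
    have hev : P.ext g.1 =ᶠ[nhds (z : ℂ × ℂ)] 0 := by
      filter_upwards [hcont.eventually_ne hz', P.isOpen_toSet.mem_nhds z.2] with y hy hyP
      have hmul : f.1 ⟨y, hyP⟩ * g.1 ⟨y, hyP⟩ = 0 :=
        congrFun (congrArg Subtype.val hfg) ⟨y, hyP⟩
      rw [← P.ext_apply f.1, ← P.ext_apply g.1] at hmul
      exact (mul_eq_zero.mp hmul).resolve_left hy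
    have hzero := AnalyticOnNhd.eqOn_zero_of_preconnected_of_eventuallyEq_zero g.2
      P.isPreconnected_toSet z.2 hev w.2
    rw [P.ext_apply] at hzero
    exact hzero

instance (P : Polydisc) : IsDomain P.Hol := NoZeroDivisors.to_isDomain _

/-- The field `ℳ(U × V)` of meromorphic functions on the polydisc: every meromorphic function on a
polydisc is a quotient of two holomorphic functions. -/
abbrev Mer (P : Polydisc) : Type := FractionRing P.Hol

/-- The partial derivative `∂f/∂t` of a holomorphic function `f(t, ε)`. -/
noncomputable def dt (P : Polydisc) (f : P.Hol) : P.Hol :=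
  ⟨fun z => deriv (fun s => P.ext f.1 (s, z.1.2)) z.1.1,
    P.analytic_ext (F := fun z => fderiv ℂ (P.ext f.1) z (1, 0))
      (fun z hz => ((ContinuousLinearMap.apply ℂ ℂ ((1, 0) : ℂ × ℂ)).analyticAt _).comp
        (f.2.fderiv z hz)) fun z => by
      have h1 : HasFDerivAt (P.ext f.1) (fderiv ℂ (P.ext f.1) z) (z.1.1, z.1.2) :=
        (f.2 z z.2).differentiableAt.hasFDerivAt
      have h2 : HasDerivAt (fun s : ℂ => (s, z.1.2)) ((1, 0) : ℂ × ℂ) z.1.1 :=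
        (hasDerivAt_id _).prodMk (hasDerivAt_const _ _)
      exact (h1.comp_hasDerivAt z.1.1 h2).deriv⟩

/-- The holomorphic function `(t, ε) ↦ ε - ε₀`. -/
def epsSub (P : Polydisc) (ε₀ : ℂ) : P.Hol :=
  ⟨fun z => z.1.2 - ε₀,
    P.analytic_ext (F := fun z => z.2 - ε₀)
      (fun _ _ => analyticAt_snd.sub analyticAt_const) fun _ => rfl⟩

/-- A meromorphic function `f` is singularly perturbed at `ε₀` if, when it is written as a quotient
`f = u / v` of holomorphic functions, the denominator `v` is divisible by a strictly higher power of
`ε - ε₀` than the numerator `u`. -/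
def SingularlyPerturbedAt {P : Polydisc} (f : P.Mer) (ε₀ : ℂ) : Prop :=
  ∃ u v : P.Hol, v ≠ 0 ∧ f = algebraMap P.Hol P.Mer u / algebraMap P.Hol P.Mer v ∧
    emultiplicity (P.epsSub ε₀) u < emultiplicity (P.epsSub ε₀) v

/-- A scalar linear differential equation with leading coefficient `1` and meromorphic
coefficients, `y^(k) + c_{k-1} y^(k-1) + ... + c_0 y = 0`, where `k` is the order. -/
structure ScalarEquation (P : Polydisc) where
  order : ℕ
  coeff : Fin order → P.Mer

/-- A normalized scalar equation is singularly perturbed if at least one of its coefficients is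
singularly perturbed at some point of the parameter space `V`. -/
def ScalarEquation.SingularlyPerturbed {P : Polydisc} (E : P.ScalarEquation) : Prop :=
  ∃ i : Fin E.order, ∃ ε₀ ∈ P.V, SingularlyPerturbedAt (E.coeff i) ε₀

variable {P : Polydisc} {n : ℕ} [NeZero n]

/-- The row vectors `a^(i)` with `x₁^(i) = ∑ j, a^(i)_j x_j` along solutions of `x' = A(t, ε) x`:
`a^(0)` is the first unit vector and `a^(i+1) = ∂a^(i)/∂t + a^(i) A`. The first variable `x₁` is the
one with index `0 : Fin n`. -/
noncomputable def row (A : Matrix (Fin n) (Fin n) P.Hol) : ℕ → Fin n → P.Hol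
  | 0 => Pi.single 0 1
  | i + 1 => fun j => P.dt (row A i j) + ∑ l, row A i l * A l j

/-- The vector `a^(i)` over the field of meromorphic functions. -/
noncomputable def merRow (A : Matrix (Fin n) (Fin n) P.Hol) (i : ℕ) : Fin n → P.Mer :=
  fun j => algebraMap P.Hol P.Mer (row A i j)

theorem exists_dependent (A : Matrix (Fin n) (Fin n) P.Hol) :
    ∃ k : ℕ, ¬ LinearIndependent P.Mer (fun i : Fin (k + 1) => merRow A i) :=
  ⟨n, fun h => by simpa using h.fintype_card_le_finrank⟩

open Classical in
/-- The least `k` such that `a^(0), ..., a^(k)` are linearly dependent over `ℳ(U × V)`. -/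
noncomputable def derivedOrder (A : Matrix (Fin n) (Fin n) P.Hol) : ℕ :=
  Nat.find (exists_dependent A)

theorem linearIndependent_merRow (A : Matrix (Fin n) (Fin n) P.Hol) :
    LinearIndependent P.Mer (fun i : Fin (derivedOrder A) => merRow A i) := by
  classical
  rcases h : derivedOrder A with _ | m
  · exact linearIndependent_empty_type
  · have hm : m < Nat.find (exists_dependent A) := by
      change m < derivedOrder A
      omega
    exact not_not.mp (Nat.find_min (exists_dependent A) hm)

/-- There is exactly one decomposition `a^(k) = A_{k-1} a^(k-1) + ... + A_0 a^(0)` for the least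
`k` as above. -/
theorem existsUnique_decomposition (A : Matrix (Fin n) (Fin n) P.Hol) :
    ∃! c : Fin (derivedOrder A) → P.Mer,
      merRow A (derivedOrder A) = ∑ i, c i • merRow A i := by
  classical
  have hind := linearIndependent_merRow A
  have hdep : ¬ LinearIndependent P.Mer
      (fun i : Fin (derivedOrder A + 1) => merRow A i) := Nat.find_spec (exists_dependent A)
  have hmem : merRow A (derivedOrder A) ∈
      Submodule.span P.Mer (Set.range fun i : Fin (derivedOrder A) => merRow A i) := by
    by_contra hnot
    refine hdep ?_
    rw [linearIndependent_finSucc']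
    exact ⟨hind, by simpa [Fin.init_def] using hnot⟩
  obtain ⟨c, hc⟩ := (Submodule.mem_span_range_iff_exists_fun P.Mer).mp hmem
  refine ⟨c, hc.symm, fun d hd => ?_⟩
  exact hind.fintypeLinearCombination_injective
    (by simpa [Fintype.linearCombination_apply] using hd.symm.trans hc.symm)

/-- The derived equation `x₁^(k) - A_{k-1} x₁^(k-1) - ... - A_0 x₁ = 0` of the system
`x' = A(t, ε) x`, where `k` is least such that `a^(0), ..., a^(k)` are linearly dependent over
`ℳ(U × V)`, and the `A_i` are given by the unique decomposition
`a^(k) = A_{k-1} a^(k-1) + ... + A_0 a^(0)`. -/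
noncomputable def derivedEquation (A : Matrix (Fin n) (Fin n) P.Hol) : P.ScalarEquation where
  order := derivedOrder A
  coeff i := -(existsUnique_decomposition A).choose i

end Polydisc

/-! Fix `ε₀` in `V` and put `ϖ = ε - ε₀`. The operator `D v = ∂v/∂t + v A` satisfies the Leibniz
rule and `ϖ` is constant in `t`, so `D` acts modulo `ϖ`.

Clear denominators in the decomposition of `a^(k)` and cancel common factors `ϖ`, so that some
coefficient is prime to `ϖ`; let `m` be the largest index of such a coefficient. Let `F` be the span
of the `a^(i)` with `i < m`, and `W` the span of all iterates. Up to factors prime to `ϖ`, the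
relation puts `a^(m)` into `F + ϖ W`, and repeated application of `D` puts all of `W` there.
Nakayama's lemma in the localization at `(ϖ)` then removes `ϖ W`, so `a^(k)` is a combination of its
predecessors with a denominator prime to `ϖ` (`Prime.exists_smul_mem_span_of_relation`). By
uniqueness these are the coefficients `A_i`, so none of them has a pole along `ε = ε₀`.

The algebra requires `ϖ` to be prime and to divide no nonzero function infinitely often; the
localization is then a discrete valuation ring. Primality rests on division: a holomorphic function
vanishing on `ε = ε₀` is a multiple of `ϖ` (`Polydisc.epsSub_dvd_iff`). -/

/-! ### Analytic division by a coordinate. -/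

/-- Averaging an analytic function over a family of linear contractions fixing the base point. -/
theorem AnalyticAt.intervalIntegral_comp_contraction {E : Type*} [NormedAddCommGroup E]
    [NormedSpace ℂ E] {F : E → ℂ} {x : E} (hF : AnalyticAt ℂ F x) {L : ℝ → E →L[ℂ] E}
    (hL : Continuous L) (hL1 : ∀ τ ∈ Set.Icc (0 : ℝ) 1, ‖L τ‖ ≤ 1) :
    AnalyticAt ℂ (fun z => ∫ τ in (0 : ℝ)..1, F (x + L τ (z - x))) x := by
  obtain ⟨p, r, hp⟩ := hF
  have hcont (n : ℕ) : Continuous fun τ => (p n).compContinuousLinearMap (fun _ => L τ) :=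
    (ContinuousMultilinearMap.compContinuousLinearMapContinuousMultilinear ℂ (fun _ : Fin n => E)
      (fun _ : Fin n => E) ℂ).cont.clm_apply continuous_const |>.comp
        (continuous_pi fun _ => hL)
  have hnorm (n : ℕ) {τ : ℝ} (hτ : τ ∈ Set.Icc (0 : ℝ) 1) :
      ‖(p n).compContinuousLinearMap (fun _ => L τ)‖ ≤ ‖p n‖ := by
    refine ((p n).norm_compContinuousLinearMap_le _).trans ?_
    exact mul_le_of_le_one_right (norm_nonneg _)
      (Finset.prod_le_one (fun _ _ => norm_nonneg _) fun _ _ => hL1 τ hτ)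
  have hmem {τ : ℝ} (hτ : τ ∈ Set.uIoc (0 : ℝ) 1) : τ ∈ Set.Icc (0 : ℝ) 1 := by
    rw [Set.uIoc_of_le zero_le_one] at hτ
    exact Set.Ioc_subset_Icc_self hτ
  -- Averaging the power series of `F` term by term: as `‖L τ‖ ≤ 1`, the norms stay below `‖p n‖`,
  -- so the same `r` works.
  let q : FormalMultilinearSeries ℂ E ℂ := fun n =>
    ∫ τ in (0 : ℝ)..1, (p n).compContinuousLinearMap (fun _ => L τ)
  refine ⟨q, r, ?_, hp.r_pos, fun {y} hy => ?_⟩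
  · refine hp.r_le.trans (FormalMultilinearSeries.radius_le_of_le fun n => ?_)
    simpa using intervalIntegral.norm_integral_le_of_norm_le_const
      (a := (0 : ℝ)) (b := 1) fun τ hτ => hnorm n (hmem hτ)
  · have hq (n : ℕ) : q n (fun _ => y) = ∫ τ in (0 : ℝ)..1, p n (fun _ => L τ y) :=
      ((ContinuousMultilinearMap.apply ℂ (fun _ : Fin n => E) ℂ
        (fun _ => y)).intervalIntegral_comp_comm ((hcont n).intervalIntegrable _ _)).symm
    have hyr : ‖y‖ₑ < p.radius := by
      have := hy
      rw [Metric.mem_eball, edist_zero_right] at this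
      exact this.trans_le hp.r_le
    simp only [hq, add_sub_cancel_left]
    refine intervalIntegral.hasSum_integral_of_dominated_convergence
      (fun n _ => ‖p n‖ * ‖y‖ ^ n) (fun n => ?_) (fun n => ?_) ?_ ?_ ?_
    · exact ((ContinuousMultilinearMap.apply ℂ (fun _ : Fin n => E) ℂ
        (fun _ => y)).continuous.comp (hcont n)).aestronglyMeasurable
    · refine Filter.Eventually.of_forall fun τ hτ => ?_
      have h1 := ((p n).compContinuousLinearMap (fun _ => L τ)).le_opNorm (fun _ => y)
      simp only [Finset.prod_const, Finset.card_univ, Fintype.card_fin] at h1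
      exact h1.trans (mul_le_mul_of_nonneg_right (hnorm n (hmem hτ)) (by positivity))
    · exact Filter.Eventually.of_forall fun τ _ =>
        p.summable_norm_mul_pow (r := ‖y‖₊) hyr
    · exact intervalIntegrable_const
    · refine Filter.Eventually.of_forall fun τ hτ => hp.hasSum ?_
      rw [Metric.mem_eball, edist_zero_right] at hy ⊢
      refine lt_of_le_of_lt ?_ hy
      rw [enorm_le_iff_norm_le]
      exact ((L τ).le_opNorm y).trans
        (mul_le_of_le_one_left (norm_nonneg _) (hL1 τ (hmem hτ)))

/-- A function analytic at `x` which vanishes on the line `z.2 = x.2` near `x` becomes analytic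
after division by `z.2 - x.2`. -/
theorem AnalyticAt.exists_eq_sub_mul {f : ℂ × ℂ → ℂ} {x : ℂ × ℂ} (hf : AnalyticAt ℂ f x)
    (h0 : ∀ᶠ z in nhds x, f (z.1, x.2) = 0) :
    ∃ g : ℂ × ℂ → ℂ, AnalyticAt ℂ g x ∧ ∀ᶠ z in nhds x, f z = (z.2 - x.2) * g z := by
  -- Only the second coordinate is contracted, so `x + L τ (z - x)` runs from `(z.1, x.2)`, where
  -- `f` vanishes, to `z`.
  let L : ℝ → ℂ × ℂ →L[ℂ] ℂ × ℂ := fun τ =>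
    (ContinuousLinearMap.inl ℂ ℂ ℂ).comp (ContinuousLinearMap.fst ℂ ℂ ℂ) +
      (τ : ℂ) • (ContinuousLinearMap.inr ℂ ℂ ℂ).comp (ContinuousLinearMap.snd ℂ ℂ ℂ)
  have hLapp (τ : ℝ) (y : ℂ × ℂ) : L τ y = (y.1, (τ : ℂ) * y.2) := by
    simp [L]
  have hLc : Continuous L :=
    continuous_const.add (Complex.continuous_ofReal.smul continuous_const)
  have hLle (τ : ℝ) (hτ : τ ∈ Set.Icc (0 : ℝ) 1) (y : ℂ × ℂ) : ‖L τ y‖ ≤ ‖y‖ := by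
    rw [hLapp, Prod.norm_def, Prod.norm_def]
    refine max_le_max le_rfl ?_
    rw [norm_mul, Complex.norm_real, Real.norm_of_nonneg hτ.1]
    exact mul_le_of_le_one_left (norm_nonneg _) hτ.2
  have hL1 (τ : ℝ) (hτ : τ ∈ Set.Icc (0 : ℝ) 1) : ‖L τ‖ ≤ 1 :=
    ContinuousLinearMap.opNorm_le_bound _ zero_le_one fun y => by simpa using hLle τ hτ y
  have hF : AnalyticAt ℂ (fun z => fderiv ℂ f z (0, 1)) x :=
    ((ContinuousLinearMap.apply ℂ ℂ ((0, 1) : ℂ × ℂ)).analyticAt _).comp hf.fderiv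
  -- By the fundamental theorem of calculus, the quotient is the mean of `∂f/∂ε` over that segment.
  refine ⟨_, hF.intervalIntegral_comp_contraction hLc hL1, ?_⟩
  obtain ⟨ρ, hρ, hball⟩ := hf.exists_ball_analyticOnNhd
  filter_upwards [h0, Metric.ball_mem_nhds x hρ] with z hz hzb
  have hpath (τ : ℝ) (hτ : τ ∈ Set.Icc (0 : ℝ) 1) : x + L τ (z - x) ∈ Metric.ball x ρ := by
    rw [mem_ball_iff_norm, add_sub_cancel_left]
    exact (hLle τ hτ _).trans_lt (mem_ball_iff_norm.mp hzb)
  have hpathderiv (τ : ℝ) : HasDerivAt (fun τ : ℝ => x + L τ (z - x))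
      (0, z.2 - x.2) τ := by
    have h1 : (fun τ : ℝ => x + L τ (z - x)) =
        fun τ : ℝ => (z.1, x.2 + (τ : ℂ) * (z.2 - x.2)) := by
      funext τ
      rw [hLapp]
      ext <;> simp
    rw [h1]
    have h2 := ((Complex.ofRealCLM.hasDerivAt (x := τ)).mul_const (z.2 - x.2)).const_add x.2
    simpa using (hasDerivAt_const τ z.1).prodMk h2
  have hderiv (τ : ℝ) (hτ : τ ∈ Set.Icc (0 : ℝ) 1) :
      HasDerivAt (fun τ : ℝ => f (x + L τ (z - x)))
        ((z.2 - x.2) * fderiv ℂ f (x + L τ (z - x)) (0, 1)) τ := by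
    have h1 := (hball _ (hpath τ hτ)).differentiableAt.hasFDerivAt.restrictScalars ℝ
    have h2 := h1.comp_hasDerivAt τ (hpathderiv τ)
    have h3 : ((0, z.2 - x.2) : ℂ × ℂ) = (z.2 - x.2) • ((0, 1) : ℂ × ℂ) := by simp
    rwa [ContinuousLinearMap.coe_restrictScalars', h3, map_smul, smul_eq_mul] at h2
  have hcont : ContinuousOn (fun τ : ℝ =>
      (z.2 - x.2) * fderiv ℂ f (x + L τ (z - x)) (0, 1)) (Set.uIcc 0 1) := by
    rw [Set.uIcc_of_le zero_le_one]
    refine continuousOn_const.mul ?_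
    intro τ hτ
    refine ContinuousAt.continuousWithinAt ?_
    have h1 : ContinuousAt (fun z => fderiv ℂ f z (0, 1)) (x + L τ (z - x)) :=
      ((hball _ (hpath τ hτ)).fderiv.continuousAt).clm_apply continuousAt_const
    exact h1.comp (f := fun τ : ℝ => x + L τ (z - x)) (hpathderiv τ).continuousAt
  have hint := intervalIntegral.integral_eq_sub_of_hasDerivAt
    (fun τ hτ => hderiv τ (by rwa [Set.uIcc_of_le zero_le_one] at hτ)) hcont.intervalIntegrable
  rw [intervalIntegral.integral_const_mul] at hint
  rw [hint, hLapp, hLapp]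
  have e0 : x + ((z - x).1, ((0 : ℝ) : ℂ) * (z - x).2) = (z.1, x.2) := by ext <;> simp
  have e1 : x + ((z - x).1, ((1 : ℝ) : ℂ) * (z - x).2) = z := by ext <;> simp
  rw [e0, e1, hz, sub_zero]
-- Commutative algebra at a prime element.
open IsLocalRing in
/-- The localization of a domain at a prime element dividing no nonzero element infinitely often
is noetherian. -/
theorem Prime.isNoetherianRing_localization {O : Type*} [CommRing O] [IsDomain O] {ϖ : O}
    (hϖ : Prime ϖ) (hfin : ∀ f : O, f ≠ 0 → FiniteMultiplicity ϖ f)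
    [hp : (Ideal.span {ϖ}).IsPrime] :
    IsNoetherianRing (Localization.AtPrime (Ideal.span {ϖ})) := by
  set p := Ideal.span {ϖ} with hpdef
  let R := Localization.AtPrime p
  have hdom : IsDomain R :=
    IsLocalization.isDomain_localization p.primeCompl_le_nonZeroDivisors
  have hmemp (s : O) : s ∈ p.primeCompl ↔ ¬ ϖ ∣ s := by
    rw [Ideal.mem_primeCompl_iff, hpdef, Ideal.mem_span_singleton]
  have hprime : Prime (algebraMap O R ϖ) := by
    have hmax : maximalIdeal R = Ideal.span {algebraMap O R ϖ} := by
      rw [← Localization.AtPrime.map_eq_maximalIdeal]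
      exact (Ideal.map_span _ _).trans (by rw [Set.image_singleton])
    rw [← Ideal.span_singleton_prime, ← hmax]
    · infer_instance
    · exact fun h => hϖ.ne_zero ((IsLocalization.injective R
        p.primeCompl_le_nonZeroDivisors) (h.trans (map_zero _).symm))
  -- Taking the full power of `ϖ` out of a numerator leaves a unit of `R`.
  have key : IsDiscreteValuationRing.HasUnitMulPowIrreducibleFactorization R := by
    refine ⟨algebraMap O R ϖ, hprime.irreducible, fun {x} hx => ?_⟩
    obtain ⟨u, s, rfl⟩ := IsLocalization.exists_mk'_eq p.primeCompl x
    have hu : u ≠ 0 := by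
      rintro rfl
      exact hx (IsLocalization.mk'_zero s)
    obtain ⟨c, hc, hcu⟩ := (hfin u hu).exists_eq_pow_mul_and_not_dvd
    refine ⟨multiplicity ϖ u, ?_⟩
    have hcunit : IsUnit (algebraMap O R c) :=
      IsLocalization.map_units R (⟨c, (hmemp c).mpr hcu⟩ : p.primeCompl)
    have hs : IsUnit (algebraMap O R s) := IsLocalization.map_units R s
    have h1 : Associated (algebraMap O R ϖ ^ multiplicity ϖ u) (algebraMap O R u) := by
      refine ⟨hcunit.unit, ?_⟩
      conv_rhs => rw [hc]
      simp
    refine h1.trans ⟨(hs.unit⁻¹), ?_⟩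
    rw [← IsLocalization.mk'_spec R u s, mul_assoc]
    simp
  have := IsDiscreteValuationRing.ofHasUnitMulPowIrreducibleFactorization key
  infer_instance

open IsLocalRing in
/-- A form of Nakayama's lemma at a prime element: if, up to factors not divisible by `ϖ`, all of
`W` lies in `F + ϖ W`, then it lies in `F` up to such factors. -/
theorem Prime.exists_smul_mem_of_forall_exists_smul_mem {O M : Type*} [CommRing O] [IsDomain O]
    [AddCommGroup M] [Module O M] [Module.Finite O M] {ϖ : O} (hϖ : Prime ϖ)
    (hfin : ∀ f : O, f ≠ 0 → FiniteMultiplicity ϖ f) {F W : Submodule O M}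
    (h : ∀ w ∈ W, ∃ s : O, ¬ ϖ ∣ s ∧ ∃ f ∈ F, ∃ w' ∈ W, s • w = f + ϖ • w') :
    ∀ w ∈ W, ∃ s : O, ¬ ϖ ∣ s ∧ s • w ∈ F := by
  have hp : (Ideal.span {ϖ}).IsPrime := (Ideal.span_singleton_prime hϖ.ne_zero).mpr hϖ
  have hnoeth := hϖ.isNoetherianRing_localization hfin
  set p := Ideal.span {ϖ} with hpdef
  have hmemp (s : O) : s ∈ p.primeCompl ↔ ¬ ϖ ∣ s := by
    rw [Ideal.mem_primeCompl_iff, hpdef, Ideal.mem_span_singleton]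
  let R := Localization.AtPrime p
  let N := LocalizedModule p.primeCompl M
  let ι := LocalizedModule.mkLinearMap p.primeCompl M
  have hN : Module.Finite R N := Module.Finite.of_isLocalizedModule p.primeCompl ι
  let W' := W.localized' R p.primeCompl ι
  let F' := F.localized' R p.primeCompl ι
  have hle : W' ≤ F' ⊔ maximalIdeal R • W' := by
    rintro _ ⟨w, hw, t, rfl⟩
    obtain ⟨s, hs, f, hf, w', hw', e⟩ := h w hw
    let s' : p.primeCompl := ⟨s, (hmemp s).mpr hs⟩
    have h1 : IsLocalizedModule.mk' ι w t = IsLocalizedModule.mk' ι f (s' * t) +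
        algebraMap O R ϖ • IsLocalizedModule.mk' ι w' (s' * t) := by
      rw [← IsLocalizedModule.mk'_cancel_left ι w s' t, algebraMap_smul,
        ← IsLocalizedModule.mk'_smul, ← IsLocalizedModule.mk'_add]
      congr 1
    rw [h1]
    refine Submodule.add_mem_sup ⟨f, hf, _, rfl⟩ (Submodule.smul_mem_smul ?_ ⟨w', hw', _, rfl⟩)
    rw [← Localization.AtPrime.map_eq_maximalIdeal]
    exact Ideal.mem_map_of_mem _ (Ideal.mem_span_singleton_self ϖ)
  -- Noetherianity of `R` supplies the finite generation of `W'` that Nakayama's lemma needs; `W`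
  -- itself need not be finitely generated over `O`.
  have hWF : W' ≤ F' := Submodule.le_of_le_smul_of_le_jacobson_bot (IsNoetherian.noetherian _)
    (maximalIdeal_le_jacobson _) hle
  intro w hw
  obtain ⟨f, hf, t, ht⟩ := hWF (⟨w, hw, 1, rfl⟩ : IsLocalizedModule.mk' ι w 1 ∈ W')
  rw [IsLocalizedModule.mk'_eq_mk'_iff] at ht
  obtain ⟨c, hc⟩ := ht
  have hc' : ((c : O) * (t : O)) • w = (c : O) • f := by
    simpa [mul_smul, Submonoid.smul_def] using hc
  exact ⟨c * t, (hmemp _).mp (c * t).2, hc' ▸ F.smul_mem _ hf⟩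

/-- Let `a i` be the iterates of `a 0` under an additive operator `D` satisfying the Leibniz rule
with respect to `d`, where `d ϖ = 0`. A linear relation among `a 0, ..., a k` whose coefficients
are not all divisible by `ϖ` allows to express `a k` by its predecessors with denominators prime
to `ϖ`. -/
theorem Prime.exists_smul_mem_span_of_relation {O M : Type*} [CommRing O] [IsDomain O]
    [AddCommGroup M] [Module O M] [Module.Finite O M] {ϖ : O} (hϖ : Prime ϖ)
    (hfin : ∀ f : O, f ≠ 0 → FiniteMultiplicity ϖ f) {d : O → O} (hd : d ϖ = 0) {D : M → M}
    (hadd : ∀ v w, D (v + w) = D v + D w) (hleib : ∀ f v, D (f • v) = d f • v + f • D v)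
    {a : ℕ → M} (ha : ∀ i, a (i + 1) = D (a i)) {k : ℕ} {c : ℕ → O}
    (hc : ∑ i ∈ Finset.range (k + 1), c i • a i = 0) (hck : ∃ i ≤ k, ¬ ϖ ∣ c i) :
    ∃ s : O, ¬ ϖ ∣ s ∧ s • a k ∈ Submodule.span O (a '' Set.Iio k) := by
  classical
  let F : ℕ → Submodule O M := fun m => Submodule.span O (a '' Set.Iio m)
  let W : Submodule O M := Submodule.span O (Set.range a)
  have haW (i : ℕ) : a i ∈ W := Submodule.subset_span ⟨i, rfl⟩
  have haF {i m : ℕ} (h : i < m) : a i ∈ F m := Submodule.subset_span ⟨i, h, rfl⟩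
  have hD0 : D 0 = 0 := by simpa using hadd 0 0
  -- Membership of `x` itself is carried through the induction because `D (f • x)` contains the term
  -- `d f • x`.
  have hDspan {S : Set M} {Q : Submodule O M} (hS : ∀ x ∈ S, x ∈ Q ∧ D x ∈ Q) :
      ∀ x ∈ Submodule.span O S, D x ∈ Q := by
    intro x hx
    suffices x ∈ Q ∧ D x ∈ Q from this.2
    induction hx using Submodule.span_induction with
    | mem x hx => exact hS x hx
    | zero => exact ⟨Q.zero_mem, by rw [hD0]; exact Q.zero_mem⟩
    | add x y _ _ hx hy => exact ⟨Q.add_mem hx.1 hy.1, hadd x y ▸ Q.add_mem hx.2 hy.2⟩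
    | smul f x _ hx => exact ⟨Q.smul_mem _ hx.1,
        hleib f x ▸ Q.add_mem (Q.smul_mem _ hx.1) (Q.smul_mem _ hx.2)⟩
  have hDF (m : ℕ) : ∀ x ∈ F m, D x ∈ F (m + 1) := hDspan <| by
    rintro _ ⟨i, hi, rfl⟩
    rw [← ha]
    exact ⟨haF (Nat.lt_succ_of_lt hi), haF (Nat.succ_lt_succ hi)⟩
  have hDW : ∀ x ∈ W, D x ∈ W := hDspan <| by
    rintro _ ⟨i, rfl⟩
    rw [← ha]
    exact ⟨haW _, haW _⟩
  -- Beyond `m` the coefficients vanish modulo `ϖ`, so there the relation expresses `c m • a m` by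
  -- the predecessors of `a m`.
  obtain ⟨m, ⟨hmk, hm⟩, hmax⟩ : ∃ m, (m ≤ k ∧ ¬ ϖ ∣ c m) ∧ ∀ i, m < i → i ≤ k → ϖ ∣ c i := by
    obtain ⟨i, hik, hi⟩ := hck
    refine ⟨Nat.findGreatest (fun i => ¬ ϖ ∣ c i) k,
      ⟨Nat.findGreatest_le _, Nat.findGreatest_spec (P := fun i => ¬ ϖ ∣ c i) hik hi⟩, ?_⟩
    intro j hj hjk
    exact not_not.mp (Nat.findGreatest_is_greatest hj hjk)
  -- `S` is the saturation of `F m + ϖ W` under factors prime to `ϖ`, that is, the elements that lie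
  -- in it after localization.
  let S : Submodule O M :=
    { carrier := {w | ∃ s : O, ¬ ϖ ∣ s ∧ ∃ f ∈ F m, ∃ w' ∈ W, s • w = f + ϖ • w'}
      zero_mem' := ⟨1, hϖ.not_dvd_one, 0, Submodule.zero_mem _, 0, Submodule.zero_mem _, by simp⟩
      add_mem' := by
        rintro v w ⟨s, hs, f, hf, v', hv', hv⟩ ⟨t, ht, g, hg, w', hw', hw⟩
        refine ⟨s * t, fun h => (hϖ.dvd_or_dvd h).elim hs ht, t • f + s • g,
          add_mem (Submodule.smul_mem _ _ hf) (Submodule.smul_mem _ _ hg), t • v' + s • w',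
          add_mem (Submodule.smul_mem _ _ hv') (Submodule.smul_mem _ _ hw'), ?_⟩
        have : (s * t) • (v + w) = t • s • v + s • t • w := by module
        rw [this, hv, hw]
        module
      smul_mem' := by
        rintro g w ⟨s, hs, f, hf, w', hw', hw⟩
        refine ⟨s, hs, g • f, Submodule.smul_mem _ _ hf, g • w', Submodule.smul_mem _ _ hw', ?_⟩
        rw [smul_comm, hw]
        module }
  have hFS : F m ≤ S := fun f hf => ⟨1, hϖ.not_dvd_one, f, hf, 0, Submodule.zero_mem _, by simp⟩
  have hWS {w : M} (hw : w ∈ W) : ϖ • w ∈ S :=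
    ⟨1, hϖ.not_dvd_one, 0, Submodule.zero_mem _, w, hw, by simp⟩
  have hsat {s : O} (hs : ¬ ϖ ∣ s) {w : M} (hw : s • w ∈ S) : w ∈ S := by
    obtain ⟨t, ht, f, hf, w', hw', e⟩ := hw
    exact ⟨t * s, fun h => (hϖ.dvd_or_dvd h).elim ht hs, f, hf, w', hw', by rw [mul_smul, e]⟩
  have ham : a m ∈ S := by
    refine hsat hm ?_
    rw [← Finset.add_sum_erase _ _ (Finset.mem_range.mpr (Nat.lt_succ_of_le hmk))] at hc
    rw [eq_neg_of_add_eq_zero_left hc]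
    refine S.neg_mem (S.sum_mem fun i hi => ?_)
    rw [Finset.mem_erase, Finset.mem_range] at hi
    rcases lt_or_gt_of_ne hi.1 with h | h
    · exact S.smul_mem _ (hFS (haF h))
    · obtain ⟨b, hb⟩ := hmax i h (Nat.le_of_lt_succ hi.2)
      rw [hb, mul_smul]
      exact hWS (W.smul_mem _ (haW i))
  have hFS' : F (m + 1) ≤ S := by
    refine Submodule.span_le.mpr ?_
    rintro _ ⟨i, hi, rfl⟩
    rcases (Nat.lt_succ_iff_lt_or_eq.mp hi) with h | rfl
    · exact hFS (haF h)
    · exact ham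
  have haS (j : ℕ) : a j ∈ S := by
    induction j with
    | zero => exact hFS' (haF (Nat.succ_pos m))
    | succ j ih =>
      obtain ⟨s, hs, f, hf, w', hw', e⟩ := id ih
      refine hsat hs ?_
      -- Apply `D` to `s • a j = f + ϖ • w'`. As `d ϖ = 0`, the last term stays in `ϖ W`; the extra
      -- term `d s • a j` is covered by the induction hypothesis.
      have h1 : s • a (j + 1) = D f + ϖ • D w' - d s • a j := by
        have h2 := congrArg D e
        rw [hleib, hadd, hleib, hd, zero_smul, zero_add, ← ha] at h2
        rw [← h2]
        abel
      rw [h1]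
      exact S.sub_mem (S.add_mem (hFS' (hDF m f hf)) (hWS (hDW w' hw'))) (S.smul_mem _ ih)
  have hWleS : W ≤ S := Submodule.span_le.mpr (by rintro _ ⟨i, rfl⟩; exact haS i)
  obtain ⟨s, hs, hmem⟩ := hϖ.exists_smul_mem_of_forall_exists_smul_mem hfin hWleS (a k) (haW k)
  exact ⟨s, hs, Submodule.span_mono (Set.image_mono (Set.Iio_subset_Iio hmk)) hmem⟩

/-- Common factors `ϖ` of the coefficients of a nontrivial linear relation can be removed. -/
theorem exists_relation_not_forall_dvd {O M : Type*} [CommRing O] [IsDomain O]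
    [AddCommGroup M] [Module O M] [Module.IsTorsionFree O M] {ϖ : O} (hϖ : ϖ ≠ 0)
    {a : ℕ → M} {k N : ℕ} {c : ℕ → O} (hc : ∑ i ∈ Finset.range (k + 1), c i • a i = 0)
    (hck : ¬ ϖ ^ N ∣ c k) :
    ∃ c' : ℕ → O, ∑ i ∈ Finset.range (k + 1), c' i • a i = 0 ∧ ∃ i ≤ k, ¬ ϖ ∣ c' i := by
  -- Each cancellation of `ϖ` lowers the exponent `N`, and `¬ ϖ ^ 0 ∣ c k` is impossible, so the
  -- process stops.
  induction N generalizing c with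
  | zero => exact absurd (by simp) hck
  | succ N ih =>
    by_cases h : ∃ i ≤ k, ¬ ϖ ∣ c i
    · exact ⟨c, hc, h⟩
    push Not at h
    have h' : ∀ i, ∃ b, i ≤ k → c i = ϖ * b := fun i => by
      by_cases hi : i ≤ k
      · obtain ⟨b, hb⟩ := h i hi
        exact ⟨b, fun _ => hb⟩
      · exact ⟨0, fun h => absurd h hi⟩
    choose b hb using h'
    refine ih (c := b) ?_ fun hdvd => hck ?_
    · have h1 : ϖ • ∑ i ∈ Finset.range (k + 1), b i • a i = 0 := by
        rw [← hc, Finset.smul_sum]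
        refine Finset.sum_congr rfl fun i hi => ?_
        rw [hb i (Nat.le_of_lt_succ (Finset.mem_range.mp hi)), mul_smul]
      exact (smul_eq_zero.mp h1).resolve_left hϖ
    · rw [hb k le_rfl, pow_succ']
      exact mul_dvd_mul_left ϖ hdvd

/-! ### The derivation `∂/∂t` and the prime `ε - ε₀` in the ring of holomorphic functions. -/

namespace Polydisc

theorem ext_add (P : Polydisc) (f g : P.toSet → ℂ) : P.ext (f + g) = P.ext f + P.ext g := by
  funext z
  by_cases hz : z ∈ P.toSet
  · simp [P.ext_apply _ ⟨z, hz⟩]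
  · have h : ¬ ∃ w : P.toSet, (w : ℂ × ℂ) = z := fun ⟨w, hw⟩ => hz (hw ▸ w.2)
    simp [ext, Function.extend_apply' _ _ _ h]

theorem ext_mul (P : Polydisc) (f g : P.toSet → ℂ) : P.ext (f * g) = P.ext f * P.ext g := by
  funext z
  by_cases hz : z ∈ P.toSet
  · simp [P.ext_apply _ ⟨z, hz⟩]
  · have h : ¬ ∃ w : P.toSet, (w : ℂ × ℂ) = z := fun ⟨w, hw⟩ => hz (hw ▸ w.2)
    simp [ext, Function.extend_apply' _ _ _ h]

theorem hasDerivAt_ext_dt {P : Polydisc} (f : P.Hol) (z : P.toSet) :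
    HasDerivAt (fun s => P.ext f.1 (s, z.1.2)) ((P.dt f).1 z) z.1.1 := by
  have h1 : HasFDerivAt (P.ext f.1) (fderiv ℂ (P.ext f.1) z) (z.1.1, z.1.2) :=
    (f.2 z z.2).differentiableAt.hasFDerivAt
  have h2 : HasDerivAt (fun s : ℂ => (s, z.1.2)) ((1, 0) : ℂ × ℂ) z.1.1 :=
    (hasDerivAt_id _).prodMk (hasDerivAt_const _ _)
  exact (h1.comp_hasDerivAt z.1.1 h2).differentiableAt.hasDerivAt

theorem dt_add {P : Polydisc} (f g : P.Hol) : P.dt (f + g) = P.dt f + P.dt g := by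
  refine Subtype.ext (funext fun z => (hasDerivAt_ext_dt (f + g) z).unique ?_)
  have h := (hasDerivAt_ext_dt f z).add (hasDerivAt_ext_dt g z)
  exact h.congr_of_eventuallyEq
    (Filter.Eventually.of_forall fun s => congrFun (P.ext_add f.1 g.1) (s, z.1.2))

theorem dt_mul {P : Polydisc} (f g : P.Hol) : P.dt (f * g) = P.dt f * g + f * P.dt g := by
  refine Subtype.ext (funext fun z => (hasDerivAt_ext_dt (f * g) z).unique ?_)
  have h := (hasDerivAt_ext_dt f z).mul (hasDerivAt_ext_dt g z)
  refine (h.congr_of_eventuallyEq (Filter.Eventually.of_forall fun s =>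
    congrFun (P.ext_mul f.1 g.1) (s, z.1.2))).congr_deriv ?_
  change _ * P.ext g.1 z + P.ext f.1 z * _ = _
  rw [P.ext_apply, P.ext_apply]
  rfl

theorem dt_epsSub (P : Polydisc) (ε₀ : ℂ) : P.dt (P.epsSub ε₀) = 0 := by
  refine Subtype.ext (funext fun z => (hasDerivAt_ext_dt (P.epsSub ε₀) z).unique ?_)
  refine (hasDerivAt_const z.1.1 (z.1.2 - ε₀)).congr_of_eventuallyEq ?_
  filter_upwards [Metric.isOpen_ball.mem_nhds z.2.1] with s hs
  exact P.ext_apply _ ⟨(s, z.1.2), hs, z.2.2⟩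

/-- Away from the line `ε = ε₀` the quotient is analytic, and near each of its points
`AnalyticAt.exists_eq_sub_mul` provides an analytic quotient. Divisibility thus becomes vanishing of
the restriction to the line. -/
theorem epsSub_dvd_iff {P : Polydisc} {ε₀ : ℂ} (hε : ε₀ ∈ P.V) (f : P.Hol) :
    P.epsSub ε₀ ∣ f ↔ ∀ t ∈ P.U, P.ext f.1 (t, ε₀) = 0 := by
  classical
  constructor
  · rintro ⟨g, rfl⟩ t ht
    rw [P.ext_apply _ ⟨(t, ε₀), ht, hε⟩]
    change (ε₀ - ε₀) * _ = 0
    rw [sub_self, zero_mul]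
  · intro h
    let F := P.ext f.1
    -- On the line the quotient must take its limit value `∂f/∂ε`, which makes `G` agree with every
    -- local quotient.
    let G : ℂ × ℂ → ℂ := fun z =>
      if z.2 = ε₀ then deriv (fun e => F (z.1, e)) ε₀ else F z / (z.2 - ε₀)
    have hG : AnalyticOnNhd ℂ G P.toSet := by
      rintro ⟨t, e⟩ hz
      by_cases he : e = ε₀
      · subst he
        obtain ⟨g, hg, hfg⟩ := (f.2 _ hz).exists_eq_sub_mul (by
          filter_upwards [P.isOpen_toSet.mem_nhds hz] with w hw
          exact h _ hw.1)
        refine hg.congr ?_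
        filter_upwards [hg.eventually_analyticAt, hfg.eventually_nhds] with w hgw hfw
        obtain ⟨t', e'⟩ := w
        simp only [G]
        split_ifs with hw
        · subst hw
          have hc : ContinuousAt (fun e : ℂ => (t', e)) e' :=
            continuousAt_const.prodMk continuousAt_id
          have hev : (fun x => F (t', x)) =ᶠ[nhds e'] fun x => (x - e') * g (t', x) :=
            hc.eventually hfw
          have hd : DifferentiableAt ℂ (fun x => g (t', x)) e' :=
            hgw.differentiableAt.comp (f := fun e : ℂ => (t', e)) e'
              ((differentiableAt_const _).prodMk differentiableAt_id)
          have hprod : HasDerivAt (fun x => (x - e') * g (t', x))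
              (1 * g (t', e') + (e' - e') * deriv (fun x => g (t', x)) e') e' :=
            ((hasDerivAt_id e').sub_const e').mul hd.hasDerivAt
          rw [hev.deriv_eq, hprod.deriv, sub_self, zero_mul, add_zero, one_mul]
        · have h1 := hfw.self_of_nhds
          change F (t', e') = (e' - e) * g (t', e') at h1
          rw [h1, mul_div_cancel_left₀ _ (sub_ne_zero.mpr hw)]
      · have h1 : AnalyticAt ℂ (fun z : ℂ × ℂ => F z / (z.2 - ε₀)) (t, e) :=
          (f.2 _ hz).div (analyticAt_snd.sub analyticAt_const) (sub_ne_zero.mpr he)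
        refine h1.congr ?_
        filter_upwards [continuousAt_snd.eventually_ne he] with w hw
        simp only [G, if_neg hw]
    refine ⟨⟨fun z => G z, P.analytic_ext hG fun _ => rfl⟩, Subtype.ext (funext fun z => ?_)⟩
    change f.1 z = (z.1.2 - ε₀) * G z
    simp only [G]
    split_ifs with hz
    · rw [hz, sub_self, zero_mul, ← P.ext_apply f.1]
      have := h z.1.1 z.2.1
      rwa [← hz] at this
    · rw [mul_div_cancel₀ _ (sub_ne_zero.mpr hz)]
      exact (P.ext_apply _ _).symm

theorem analyticOnNhd_ext_left {P : Polydisc} (f : P.Hol) {ε : ℂ} (hε : ε ∈ P.V) :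
    AnalyticOnNhd ℂ (fun t => P.ext f.1 (t, ε)) P.U := fun t ht =>
  AnalyticAt.comp (f := fun t : ℂ => (t, ε)) (f.2 (t, ε) ⟨ht, hε⟩)
    (analyticAt_id.prod analyticAt_const)

theorem analyticOnNhd_ext_right {P : Polydisc} (f : P.Hol) {t : ℂ} (ht : t ∈ P.U) :
    AnalyticOnNhd ℂ (fun e => P.ext f.1 (t, e)) P.V := fun e he =>
  AnalyticAt.comp (f := fun e : ℂ => (t, e)) (f.2 (t, e) ⟨ht, he⟩)
    (analyticAt_const.prod analyticAt_id)

theorem epsSub_ne_zero (P : Polydisc) (ε₀ : ℂ) : P.epsSub ε₀ ≠ 0 := by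
  intro h
  have h1 (e : ℂ) (he : e ∈ P.V) : e = ε₀ := sub_eq_zero.mp <| congrFun
    (congrArg Subtype.val h) ⟨(P.tCenter, e), Metric.mem_ball_self P.tRadius_pos, he⟩
  have h2 : P.epsCenter + (P.epsRadius / 2 : ℝ) ∈ P.V := by
    rw [V, mem_ball_iff_norm, add_sub_cancel_left, Complex.norm_real, Real.norm_of_nonneg]
    · exact half_lt_self P.epsRadius_pos
    · exact (half_pos P.epsRadius_pos).le
  have h3 := (h1 _ h2).trans (h1 _ (Metric.mem_ball_self P.epsRadius_pos)).symm
  rw [add_eq_left, Complex.ofReal_eq_zero] at h3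
  exact (half_pos P.epsRadius_pos).ne' h3

/-- Restrictions to the line `ε = ε₀` are analytic on the connected disc `U`, where a product
vanishes identically only if a factor does. -/
theorem prime_epsSub {P : Polydisc} {ε₀ : ℂ} (hε : ε₀ ∈ P.V) : Prime (P.epsSub ε₀) := by
  refine ⟨P.epsSub_ne_zero ε₀, fun h => ?_, fun f g hfg => ?_⟩
  · have h1 := (epsSub_dvd_iff hε 1).mp h.dvd P.tCenter (Metric.mem_ball_self P.tRadius_pos)
    rw [P.ext_apply _ ⟨(P.tCenter, ε₀), Metric.mem_ball_self P.tRadius_pos, hε⟩] at h1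
    exact one_ne_zero h1
  · rw [epsSub_dvd_iff hε] at hfg ⊢
    rw [epsSub_dvd_iff hε]
    by_contra! hne
    obtain ⟨⟨t, ht, hft⟩, t', ht', hgt⟩ := hne
    have hU : IsPreconnected P.U := (convex_ball _ _).isPreconnected
    have hev : (fun s => P.ext g.1 (s, ε₀)) =ᶠ[nhds t] 0 := by
      filter_upwards [(analyticOnNhd_ext_left f hε t ht).continuousAt.eventually_ne hft,
        Metric.isOpen_ball.mem_nhds ht] with s hs hsU
      have h1 := hfg s hsU
      have h2 : P.ext (f * g).1 = P.ext f.1 * P.ext g.1 := P.ext_mul f.1 g.1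
      rw [h2] at h1
      exact (mul_eq_zero.mp h1).resolve_left hs
    exact hgt ((analyticOnNhd_ext_left g hε).eqOn_zero_of_preconnected_of_eventuallyEq_zero
      hU ht hev ht')

/-- For fixed `t`, divisibility by all powers is a zero of infinite order in `ε` at `ε₀`, which
forces vanishing on the connected disc `V`. -/
theorem finiteMultiplicity_epsSub {P : Polydisc} {ε₀ : ℂ} (hε : ε₀ ∈ P.V) {f : P.Hol}
    (hf : f ≠ 0) : FiniteMultiplicity (P.epsSub ε₀) f := by
  by_contra h
  rw [FiniteMultiplicity.not_iff_forall] at h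
  refine hf (Subtype.ext (funext fun z => ?_))
  have hφ := analyticOnNhd_ext_right f z.2.1
  have htop : analyticOrderAt (fun e => P.ext f.1 (z.1.1, e)) ε₀ = ⊤ := by
    refine ENat.eq_top_iff_forall_ge.mpr fun m => ?_
    rw [natCast_le_analyticOrderAt (hφ ε₀ hε)]
    obtain ⟨g, hg⟩ := h m
    refine ⟨_, analyticOnNhd_ext_right g z.2.1 ε₀ hε, ?_⟩
    filter_upwards [Metric.isOpen_ball.mem_nhds hε] with e he
    rw [P.ext_apply _ ⟨(z.1.1, e), z.2.1, he⟩, P.ext_apply _ ⟨(z.1.1, e), z.2.1, he⟩, hg]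
    rfl
  have hV : IsPreconnected P.V := (convex_ball _ _).isPreconnected
  have h0 := hφ.eqOn_zero_of_preconnected_of_eventuallyEq_zero hV hε
    (analyticOrderAt_eq_top.mp htop) z.2.2
  exact (P.ext_apply f.1 z).symm.trans h0

/-! ### The coefficients of the derived equation. -/

variable {P : Polydisc} {n : ℕ} [NeZero n]

/-- The coefficients of the decomposition of `a^(k)` have a common denominator which is not
divisible by `ε - ε₀`. -/
theorem exists_decomposition_not_dvd (A : Matrix (Fin n) (Fin n) P.Hol) {ε₀ : ℂ}
    (hε : ε₀ ∈ P.V) : ∃ s : P.Hol, ¬ P.epsSub ε₀ ∣ s ∧ ∃ u : Fin (derivedOrder A) → P.Hol,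
      s • row A (derivedOrder A) = ∑ i, u i • row A i := by
  have hinj : Function.Injective (algebraMap P.Hol P.Mer) := IsFractionRing.injective _ _
  obtain ⟨c, hc, -⟩ := existsUnique_decomposition A
  generalize derivedOrder A = k at c hc ⊢
  obtain ⟨b, hb⟩ := IsLocalization.exist_integer_multiples_of_finite (nonZeroDivisors P.Hol) c
  choose e he using hb
  have he' (i : Fin k) : algebraMap P.Hol P.Mer (e i) = algebraMap P.Hol P.Mer b * c i :=
    (he i).trans (Algebra.smul_def _ _)
  -- Decomposition multiplied by a common denominator `b`. The last coefficient `-b` is nonzero,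
  -- hence divisible by only finitely many powers of `ε - ε₀`.
  let r : ℕ → P.Hol := fun i => if h : i < k then e ⟨i, h⟩ else -b
  have hrel : ∑ i ∈ Finset.range (k + 1), r i • row A i = 0 := by
    rw [Finset.sum_range_succ, Finset.sum_range]
    have h1 : r k = -b := dif_neg (lt_irrefl k)
    have h2 (i : Fin k) : r i = e i := dif_pos i.2
    simp only [h1, h2]
    funext j
    refine hinj ?_
    have h3 := congrArg (algebraMap P.Hol P.Mer b * ·) (congrFun hc j)
    simp only [Finset.sum_apply, Pi.smul_apply, smul_eq_mul, Finset.mul_sum, ← mul_assoc] at h3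
    simp only [Pi.add_apply, Finset.sum_apply, Pi.smul_apply, smul_eq_mul, map_add, map_sum,
      map_mul, he', map_neg, Pi.zero_apply, map_zero]
    rw [neg_mul, ← sub_eq_add_neg, sub_eq_zero]
    exact h3.symm
  have hprime := prime_epsSub hε
  have hfin : ∀ f : P.Hol, f ≠ 0 → FiniteMultiplicity (P.epsSub ε₀) f := fun f hf =>
    finiteMultiplicity_epsSub hε hf
  obtain ⟨N, hN⟩ := hfin (r k) (by
    have h1 : r k = -b := dif_neg (lt_irrefl k)
    rw [h1, neg_ne_zero]
    exact nonZeroDivisors.ne_zero b.2)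
  obtain ⟨r', hr', hdvd⟩ := exists_relation_not_forall_dvd hprime.ne_zero hrel hN
  obtain ⟨s, hs, hmem⟩ := hprime.exists_smul_mem_span_of_relation hfin (P.dt_epsSub ε₀)
    (D := fun v : Fin n → P.Hol => fun j => P.dt (v j) + ∑ l, v l * A l j) (a := row A)
    (fun v w => by
      funext j
      simp only [Pi.add_apply, dt_add, add_mul, Finset.sum_add_distrib]
      abel)
    (fun f v => by
      funext j
      simp only [Pi.add_apply, Pi.smul_apply, smul_eq_mul, dt_mul, mul_add, Finset.mul_sum,
        mul_assoc, add_assoc])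
    (fun i => rfl) hr' hdvd
  refine ⟨s, hs, ?_⟩
  have himg : row A '' Set.Iio k = Set.range fun i : Fin k => row A i := by
    ext v
    simp only [Set.mem_image, Set.mem_Iio, Set.mem_range]
    exact ⟨fun ⟨i, hi, h⟩ => ⟨⟨i, hi⟩, h⟩, fun ⟨i, h⟩ => ⟨i, i.2, h⟩⟩
  rw [himg] at hmem
  obtain ⟨u, hu⟩ := (Submodule.mem_span_range_iff_exists_fun _).mp hmem
  exact ⟨u, hu.symm⟩

end Polydisc

theorem theorem2 (P : Polydisc) (n : ℕ) [NeZero n] (A : Matrix (Fin n) (Fin n) P.Hol) :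
    ¬ (Polydisc.derivedEquation A).SingularlyPerturbed := by
  rintro ⟨i, ε₀, hε, u, v, hv, huv, hlt⟩
  obtain ⟨s, hs, w, hw⟩ := Polydisc.exists_decomposition_not_dvd A hε
  have hinj : Function.Injective (algebraMap P.Hol P.Mer) := IsFractionRing.injective _ _
  have hs0 : algebraMap P.Hol P.Mer s ≠ 0 := by
    rw [Ne, ← map_zero (algebraMap P.Hol P.Mer), hinj.eq_iff]
    rintro rfl
    exact hs (dvd_zero _)
  have hv0 : algebraMap P.Hol P.Mer v ≠ 0 := by
    rwa [Ne, ← map_zero (algebraMap P.Hol P.Mer), hinj.eq_iff]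
  -- Uniqueness identifies the quotients `w i / s` with the coefficients `A_i`.
  have hcoeff := (Polydisc.existsUnique_decomposition A).choose_spec.2
    (fun i => algebraMap P.Hol P.Mer (w i) / algebraMap P.Hol P.Mer s) (by
      funext j
      have h1 := congrArg (algebraMap P.Hol P.Mer) (congrFun hw j)
      simp only [Pi.smul_apply, smul_eq_mul, Finset.sum_apply, map_mul, map_sum] at h1
      simp only [Polydisc.merRow, Finset.sum_apply, Pi.smul_apply, smul_eq_mul]
      rw [← mul_right_inj' hs0, h1, Finset.mul_sum]
      refine Finset.sum_congr rfl fun i _ => ?_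
      field_simp)
  have hi : -(algebraMap P.Hol P.Mer (w i) / algebraMap P.Hol P.Mer s) =
      algebraMap P.Hol P.Mer u / algebraMap P.Hol P.Mer v := by
    rw [← huv]
    exact congrArg Neg.neg (congrFun hcoeff i)
  have heq : -w i * v = u * s := by
    refine hinj ?_
    rw [← neg_div, div_eq_div_iff hs0 hv0] at hi
    simpa using hi
  have hprime := Polydisc.prime_epsSub hε
  -- In `-w i * v = u * s` the factor `s` contributes no power of `ε - ε₀`, so every power dividing
  -- `v` divides `u`.
  have hle : emultiplicity (P.epsSub ε₀) v ≤ emultiplicity (P.epsSub ε₀) u := by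
    calc emultiplicity (P.epsSub ε₀) v ≤ emultiplicity (P.epsSub ε₀) (-w i * v) :=
          emultiplicity_le_emultiplicity_of_dvd_right (dvd_mul_left _ _)
      _ = emultiplicity (P.epsSub ε₀) u := by
        rw [heq, emultiplicity_mul hprime, emultiplicity_eq_zero.mpr hs, add_zero]
  exact absurd hlt hle.not_gt
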